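/- **Theorem (Hardness of learning stabilizer states from $\mathtt{QStat}$).** Let $n\in\mathbb N$. Let $\mathrm{Cl}(2,n)\subset \mathrm U(2^n)$ be the $n$-qubit Clifford group, i.e. the normalizer of the $n$-qubit Pauli group in $\mathrm U(2^n)$, let $\mu_{\mathrm{Cl}}$ be the uniform (Haar) probability measure over it, and for $U\in\mathrm{Cl}(2,n)$ let $\rho(U)=U|0^n\rangle\langle 0^n|U^\dagger$. Let $\mathrm{Stab}(n)=\{\rho(U) : U\in\mathrm{Cl}(2,n)\}$ be the set of $n$-qubit stabilizer states. For a tolerance $\tau>0$ and a state $\rho$, the oracle $\mathtt{QStat}_\tau(\rho)$, when queried with a Hermitian $2^n\times 2^n$ matrix $O$ with $\|O\|_{\mathrm{op}}\le 1$, returns some value $v\in[\mathrm{tr}(\rho O)-\tau,\ \mathrm{tr}(\rho O)+\tau]$. Let $0<\tau\le 1$, $\beta\in(0,1]$ and $q\in\mathbb N$. Let $\mathcal A$ be an adaptive, possibly random algorithm of unbounded computational power that makes $q$ oracle queries and then outputs an element of $\mathrm{Stab}(n)$. Suppose that, for every valid (measurable) choice of the oracles' answers, $\mathcal A$ with access to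 $\mathtt{QStat}_\tau(\rho(U))$ outputs $\rho(U)$ with probability at least $\beta$ over $U\sim\mu_{\mathrm{Cl}}$ and the internal randomness of $\mathcal A$. (For a deterministic $\mathcal A$ this says that it succeeds on at least a $\beta$-fraction of the instances.) Then $$q+1\ \ge\ \beta\,\tau^2\,2^{\,n-2}.$$ -/

import Mathlib

open MeasureTheory ProbabilityTheory
open scoped Matrix ENNReal

/-! ### Qubits, Pauli and Clifford groups, stabilizer states -/

/-- Computational basis labels of `n` qubits; the Hilbert space is `ℂ ^ (Qubits n)`. -/
abbrev Qubits (n : ℕ) : Type := Fin n → Fin 2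

/-- Operators on `n` qubits, as matrices in the computational basis. -/
abbrev QMatrix (n : ℕ) : Type := Matrix (Qubits n) (Qubits n) ℂ

/-- The unitary group `U(2 ^ n)`. -/
abbrev QUnitary (n : ℕ) : Type := Matrix.unitaryGroup (Qubits n) ℂ

/-- The single-qubit matrices `1, X, Y, Z`. -/
def pauliMatrix : Fin 4 → Matrix (Fin 2) (Fin 2) ℂ :=
  ![!![1, 0; 0, 1], !![0, 1; 1, 0], !![0, -Complex.I; Complex.I, 0], !![1, 0; 0, -1]]

/-- The tensor product `σ_{p 0} ⊗ ⋯ ⊗ σ_{p (n-1)}` of single-qubit Pauli matrices. -/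
def pauliString {n : ℕ} (p : Fin n → Fin 4) : QMatrix n :=
  Matrix.of fun x y => ∏ j, pauliMatrix (p j) (x j) (y j)

/-- The elements `i ^ k σ_{p 0} ⊗ ⋯ ⊗ σ_{p (n-1)}` of the `n`-qubit Pauli group. -/
def pauliGroup (n : ℕ) : Set (QUnitary n) :=
  {P | ∃ (k : Fin 4) (p : Fin n → Fin 4), (P : QMatrix n) = Complex.I ^ (k : ℕ) • pauliString p}

/-- The `n`-qubit Clifford group: the unitaries `U` with `U 𝒫 U⁻¹ = 𝒫` for the Pauli group `𝒫`. -/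
def cliffordGroup (n : ℕ) : Subgroup (QUnitary n) :=
  Subgroup.normalizer (pauliGroup n)

theorem pauliGroup_finite (n : ℕ) : (pauliGroup n).Finite := by
  refine Set.Finite.of_finite_image (f := fun P : QUnitary n => (P : QMatrix n)) ?_
    Subtype.val_injective.injOn
  refine (Set.finite_range fun kp : Fin 4 × (Fin n → Fin 4) =>
    Complex.I ^ (kp.1 : ℕ) • (pauliString kp.2 : QMatrix n)).subset ?_
  rintro _ ⟨P, ⟨k, p, h⟩, rfl⟩
  exact ⟨(k, p), h.symm⟩

theorem isClosed_cliffordGroup (n : ℕ) : IsClosed (cliffordGroup n : Set (QUnitary n)) := by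
  have hP : IsClosed (pauliGroup n) := (pauliGroup_finite n).isClosed
  have : (cliffordGroup n : Set (QUnitary n)) =
      (⋂ P ∈ pauliGroup n, (fun U : QUnitary n => U * P * U⁻¹) ⁻¹' pauliGroup n) ∩
      (⋂ P ∈ pauliGroup n, (fun U : QUnitary n => U⁻¹ * P * U) ⁻¹' pauliGroup n) := by
    ext U
    simp only [Set.mem_inter_iff, Set.mem_iInter, Set.mem_preimage, SetLike.mem_coe]
    constructor
    · intro hU
      refine ⟨fun P h => (hU P).1 h, fun P h => ?_⟩
      have := ((cliffordGroup n).inv_mem hU P).1 h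
      simpa using this
    · rintro ⟨h₁, h₂⟩ P
      refine ⟨h₁ P, fun h => ?_⟩
      have := h₂ _ h
      simpa [mul_assoc] using this
  rw [this]
  refine IsClosed.inter ?_ ?_
  · exact isClosed_biInter fun P _ => hP.preimage
      ((continuous_id.mul continuous_const).mul continuous_inv)
  · exact isClosed_biInter fun P _ => hP.preimage
      ((continuous_inv.mul continuous_const).mul continuous_id)

instance instCompactSpaceQUnitary (n : ℕ) : CompactSpace (QUnitary n) := by
  suffices h : IsCompact (Matrix.unitaryGroup (Qubits n) ℂ : Set (QMatrix n)) from
    isCompact_iff_compactSpace.1 h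
  have hbox : IsCompact (Set.univ.pi fun _ : Qubits n =>
      Set.univ.pi fun _ : Qubits n => Metric.closedBall (0 : ℂ) 1) :=
    isCompact_univ_pi fun _ => isCompact_univ_pi fun _ => isCompact_closedBall _ _
  refine IsCompact.of_isClosed_subset (X := QMatrix n) hbox ?_ ?_
  · have : (Matrix.unitaryGroup (Qubits n) ℂ : Set (QMatrix n)) =
        {U | U * star U = 1} := by
      ext U
      exact Matrix.mem_unitaryGroup_iff
    rw [this]
    exact isClosed_eq (by fun_prop) continuous_const
  · intro U hU x _ y _
    simpa using entry_norm_bound_of_unitary hU x y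

instance instCompactSpaceClifford (n : ℕ) : CompactSpace (cliffordGroup n) :=
  isCompact_iff_compactSpace.1 (isClosed_cliffordGroup n).isCompact

noncomputable instance instMeasurableSpaceClifford (n : ℕ) : MeasurableSpace (cliffordGroup n) :=
  borel _

instance instBorelSpaceClifford (n : ℕ) : BorelSpace (cliffordGroup n) := ⟨rfl⟩

/-- The uniform measure over the Clifford group, i.e. its Haar probability measure. (The group
contains the global phases `U(1)`, which do not affect states; modulo phases it is finite and this
measure becomes the normalized counting measure.) -/
noncomputable def cliffordMeasure (n : ℕ) : Measure (cliffordGroup n) :=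
  Measure.haarMeasure ⊤

instance instIsProbabilityMeasureClifford (n : ℕ) : IsProbabilityMeasure (cliffordMeasure n) :=
  ⟨Measure.haarMeasure_self (K₀ := (⊤ : TopologicalSpace.PositiveCompacts (cliffordGroup n)))⟩

/-- The state vector `C |0⟩`. -/
noncomputable def cliffordKet {n : ℕ} (C : cliffordGroup n) : Qubits n → ℂ :=
  (C.1 : QMatrix n) *ᵥ Pi.single 0 1

/-- The pure state `|ψ⟩⟨ψ|` of a vector `|ψ⟩`. -/
def ketBra {n : ℕ} (ψ : Qubits n → ℂ) : QMatrix n :=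
  Matrix.vecMulVec ψ (star ψ)

/-- The set of `n`-qubit stabilizer states. -/
def Stab (n : ℕ) : Set (QMatrix n) :=
  {ρ | ∃ C : cliffordGroup n, ρ = ketBra (cliffordKet C)}

/-- The stabilizer state `ρ(C) = C |0⟩⟨0| C†`. -/
noncomputable def stabState {n : ℕ} (C : cliffordGroup n) : Stab n :=
  ⟨ketBra (cliffordKet C), C, rfl⟩

/-- `Stab n` is a finite set and carries the discrete `σ`-algebra. -/
instance instMeasurableSpaceStab (n : ℕ) : MeasurableSpace (Stab n) := ⊤

/-- The problem of learning stabilizer states: the only solution for `ρ` is `ρ` itself. -/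
def stabLearning (n : ℕ) : Stab n → Set (Stab n) := fun ρ => {ρ}

/-! ### Quantum statistical queries -/

/-- Admissible queries: Hermitian operators of operator norm at most one. -/
def Observable (n : ℕ) : Type :=
  {O : QMatrix n // O.IsHermitian ∧ ‖Matrix.toEuclideanCLM (𝕜 := ℂ) O‖ ≤ 1}

noncomputable instance instTopologicalSpaceObservable (n : ℕ) : TopologicalSpace (Observable n) :=
  instTopologicalSpaceSubtype

noncomputable instance instMeasurableSpaceObservable (n : ℕ) : MeasurableSpace (Observable n) := borel _

/-- `v` is a valid way to answer all queries to `QStat_τ(ρ)`: each answer `v O` lies within `τ` of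
`tr(ρ O)` (a real number, as both matrices are Hermitian). -/
def IsQStat {n : ℕ} (τ : ℝ) (ρ : QMatrix n) (v : Observable n → ℝ) : Prop :=
  Measurable v ∧ ∀ O : Observable n, |v O - (ρ * O.1).trace.re| ≤ τ

/-! ### Query algorithms -/

/-- A random algorithm, of unbounded computational power, that queries an oracle with elements of
`X`, receives real answers and outputs elements of `T`. Its memory `M` is an arbitrary measurable
space. It starts in a random memory state. In every round it makes the query `query m` determined by
the present memory state `m`, and on receiving the answer `v` it moves to a new memory state drawn
from `update (m, v)`. Queries may thus be adaptive and random (the query to come is part of the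
memory, as are the transcript and the number of rounds so far). Deterministic algorithms are those
with Dirac measures; a quantum algorithm has the classical description of its quantum state as part
of its memory. -/
structure QueryAlgorithm (X T M : Type*) [MeasurableSpace X] [MeasurableSpace T]
    [MeasurableSpace M] where
  init : Measure M
  isProbabilityMeasure_init : IsProbabilityMeasure init
  query : M → X
  measurable_query : Measurable query
  update : Kernel (M × ℝ) M
  isMarkovKernel_update : IsMarkovKernel update
  output : M → T
  measurable_output : Measurable output

/-- The law of the memory after `q` queries, answered by `v`. -/
noncomputable def QueryAlgorithm.memoryLaw {X T M : Type*} [MeasurableSpace X] [MeasurableSpace T]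
    [MeasurableSpace M] (A : QueryAlgorithm X T M) (v : X → ℝ) : ℕ → Measure M
  | 0 => A.init
  | q + 1 => (A.memoryLaw v q).bind fun m => A.update (m, v (A.query m))

/-- The probability that the output after `q` queries, answered by `v`, lies in `S`. -/
noncomputable def QueryAlgorithm.outputProb {X T M : Type*} [MeasurableSpace X] [MeasurableSpace T]
    [MeasurableSpace M] (A : QueryAlgorithm X T M) (v : X → ℝ) (q : ℕ) (S : Set T) : ℝ≥0∞ :=
  A.memoryLaw v q (A.output ⁻¹' S)

/-- `A` learns `n`-qubit stabilizer states from `q` queries to `QStat_τ` with probability at least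
`β`: however the oracles `QStat_τ(ρ)` choose their valid answers, `A` outputs a solution with
probability at least `β` over a uniform Clifford unitary `U`, which determines the unknown state
`ρ(U)`, and the internal randomness of `A`. -/
def LearnsStab {n : ℕ} {M : Type*} [MeasurableSpace M]
    (A : QueryAlgorithm (Observable n) (Stab n) M) (q : ℕ) (τ β : ℝ) : Prop :=
  ∀ v : Stab n → Observable n → ℝ, (∀ ρ : Stab n, IsQStat τ ρ.1 (v ρ)) →
    ENNReal.ofReal β ≤
      ∫⁻ U, A.outputProb (v (stabState U)) q (stabLearning n (stabState U)) ∂(cliffordMeasure n)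

/-!
The oracles may answer a query `O` with `tr(O) / 2 ^ n`, its expectation in the maximally mixed state,
whenever this is within `τ` of `tr(ρ O)`. For a random stabilizer state `ρ` such an answer is almost
always allowed, so that the queries hardly ever reveal anything about `ρ`.

* Concentration. Expand `tr(ρ O) - tr(O) / 2 ^ n` in Pauli strings `P ≠ 1`. The coefficients `tr(ρ P)`
  are uncorrelated, by invariance of the Haar measure under Pauli strings
  (`integral_pauliCoeff_mul_pauliCoeff`). For anticommuting `P` and `Q` the unitary `(P + Q) / √2` is
  Clifford and exchanges `P` and `Q`, so `tr(ρ P)` and `tr(ρ Q)` have the same second moment; as half of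
  all strings anticommute with `P ≠ 1`, and the squares of all coefficients add up to `2 ^ n`, each
  second moment is at most `2 / 2 ^ n` (`integral_pauliCoeff_sq_le`). This replaces the usual appeal to
  the Clifford group being a unitary `2`-design, at the price of a constant factor. Hence
  `tr(ρ O)` has variance at most `2 / 2 ^ n` (`integral_trace_sub_sq_le`), and by Chebyshev's
  inequality the answer `tr(O) / 2 ^ n` is not allowed with probability at most `2 / (2 ^ n τ ^ 2)`.
* Hybrid argument. Replacing the answers about `ρ` by the answers `tr(O) / 2 ^ n`, which do not depend on
  `ρ`, changes the success probability by at most the sum over the rounds of the probability that the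
  answer changes (`QueryAlgorithm.outputProb_le`).
* Guessing. An output that does not depend on `ρ` equals `ρ` with probability at most `1 / 2 ^ n`
  (`lintegral_measure_singleton_stabState_le`).

Together, `β ≤ 1 / 2 ^ n + 2 q / (2 ^ n τ ^ 2)`, which is stronger than the claim as `τ ≤ 1`.
-/

variable {n : ℕ}

/-! ### Algebra of Pauli strings -/

/-- The sign `±1` with which two single-qubit Pauli matrices commute. -/
def pauliSign (a b : Fin 4) : ℝ := if a = 0 ∨ b = 0 ∨ a = b then 1 else -1

/-- The sign `±1` with which two Pauli strings commute. -/
def stringSign {n : ℕ} (p q : Fin n → Fin 4) : ℝ := ∏ j, pauliSign (p j) (q j)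

theorem pauliMatrix_mul_comm (a b : Fin 4) :
    pauliMatrix a * pauliMatrix b = (pauliSign a b : ℂ) • (pauliMatrix b * pauliMatrix a) := by
  fin_cases a <;> fin_cases b <;> ext i j <;> fin_cases i <;> fin_cases j <;>
    simp [pauliMatrix, pauliSign, Matrix.mul_apply]

theorem exists_pauliMatrix_mul (a b : Fin 4) :
    ∃ (k : ℕ) (c : Fin 4), pauliMatrix a * pauliMatrix b = Complex.I ^ k • pauliMatrix c := by
  -- The multiplication table of `1, X, Y, Z`: the powers of `i`, and the labels of the products.
  refine ⟨(![![0, 0, 0, 0], ![0, 0, 1, 3], ![0, 3, 0, 1], ![0, 1, 3, 0]] : Fin 4 → Fin 4 → ℕ) a b,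
    (![![0, 1, 2, 3], ![1, 0, 3, 2], ![2, 3, 0, 1], ![3, 2, 1, 0]] : Fin 4 → Fin 4 → Fin 4) a b, ?_⟩
  fin_cases a <;> fin_cases b <;> ext i j <;> fin_cases i <;> fin_cases j <;>
    simp [pauliMatrix, Matrix.mul_apply, Complex.I_pow_three]

theorem sum_pauliMatrix_mul_pauliMatrix (x y z w : Fin 2) :
    ∑ a, pauliMatrix a x y * pauliMatrix a z w = if x = w ∧ y = z then 2 else 0 := by
  fin_cases x <;> fin_cases y <;> fin_cases z <;> fin_cases w <;>
    simp [pauliMatrix, Fin.sum_univ_four] <;> norm_num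

theorem sum_pauliSign_mul_pauliSign (a b : Fin 4) :
    ∑ c, pauliSign c a * pauliSign c b = if a = b then 4 else 0 := by
  fin_cases a <;> fin_cases b <;> simp [pauliSign, Fin.sum_univ_four] <;> norm_num

theorem stringSign_eq_or (p q : Fin n → Fin 4) : stringSign p q = 1 ∨ stringSign p q = -1 := by
  have h : ∀ a b, pauliSign a b ^ 2 = 1 := fun a b => by
    unfold pauliSign
    split_ifs <;> norm_num
  rw [← sq_eq_one_iff, stringSign, ← Finset.prod_pow]
  simp only [h, Finset.prod_const_one]

theorem stringSign_comm (p q : Fin n → Fin 4) : stringSign p q = stringSign q p :=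
  Finset.prod_congr rfl fun j _ => by simp only [pauliSign, eq_comm, or_left_comm]

theorem stringSign_zero_right (p : Fin n → Fin 4) : stringSign p 0 = 1 := by
  simp [stringSign, pauliSign]

theorem sum_stringSign_mul_stringSign (p q : Fin n → Fin 4) :
    ∑ r, stringSign r p * stringSign r q = if p = q then 4 ^ n else 0 := by
  simp only [stringSign, ← Finset.prod_mul_distrib]
  rw [← Fintype.piFinset_univ, ← Finset.prod_univ_sum (fun _ => Finset.univ)
    (fun j c => pauliSign c (p j) * pauliSign c (q j))]
  simp only [sum_pauliSign_mul_pauliSign, Finset.prod_ite_zero, Finset.mem_univ, true_imp_iff,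
    funext_iff, Finset.prod_const, Finset.card_univ, Fintype.card_fin]

/-- Completeness of the Pauli strings: `∑ P ⊗ P` is `2 ^ n` times the swap operator. -/
theorem sum_pauliString_mul_pauliString (x y z w : Qubits n) :
    ∑ p : Fin n → Fin 4, (pauliString p : QMatrix n) x y * (pauliString p : QMatrix n) z w =
      if x = w ∧ y = z then 2 ^ n else 0 := by
  simp only [pauliString, Matrix.of_apply, ← Finset.prod_mul_distrib]
  rw [← Fintype.piFinset_univ, ← Finset.prod_univ_sum (fun _ => Finset.univ)
    (fun j a => pauliMatrix a (x j) (y j) * pauliMatrix a (z j) (w j))]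
  simp only [sum_pauliMatrix_mul_pauliMatrix, Finset.prod_ite_zero, Finset.mem_univ, true_imp_iff,
    funext_iff, Finset.prod_const, Finset.card_univ, Fintype.card_fin, forall_and]

theorem pauliString_mul_apply (p q : Fin n → Fin 4) (x y : Qubits n) :
    (pauliString p * pauliString q : QMatrix n) x y =
      ∏ j, (pauliMatrix (p j) * pauliMatrix (q j)) (x j) (y j) := by
  simp only [Matrix.mul_apply, pauliString, Matrix.of_apply, ← Finset.prod_mul_distrib]
  rw [Finset.prod_univ_sum, Fintype.piFinset_univ]

theorem pauliString_mul_comm (p q : Fin n → Fin 4) :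
    (pauliString p * pauliString q : QMatrix n) =
      (stringSign p q : ℂ) • (pauliString q * pauliString p) := by
  ext x y
  rw [Matrix.smul_apply, pauliString_mul_apply, pauliString_mul_apply, stringSign,
    Complex.ofReal_prod, smul_eq_mul, ← Finset.prod_mul_distrib]
  refine Finset.prod_congr rfl fun j _ => ?_
  rw [pauliMatrix_mul_comm, Matrix.smul_apply, smul_eq_mul]

theorem exists_pauliString_mul (p q : Fin n → Fin 4) :
    ∃ (k : ℕ) (r : Fin n → Fin 4),
      (pauliString p * pauliString q : QMatrix n) = Complex.I ^ k • pauliString r := by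
  choose k r h using fun j => exists_pauliMatrix_mul (p j) (q j)
  refine ⟨∑ j, k j, r, ?_⟩
  ext x y
  rw [Matrix.smul_apply, pauliString_mul_apply, smul_eq_mul, ← Finset.prod_pow_eq_pow_sum,
    pauliString, Matrix.of_apply, ← Finset.prod_mul_distrib]
  refine Finset.prod_congr rfl fun j _ => ?_
  rw [h, Matrix.smul_apply, smul_eq_mul]

theorem pauliString_zero : (pauliString (0 : Fin n → Fin 4) : QMatrix n) = 1 := by
  have h : pauliMatrix 0 = 1 := by simp [pauliMatrix, Matrix.one_fin_two]
  ext x y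
  simp only [pauliString, Matrix.of_apply, Pi.zero_apply, h, Matrix.one_apply,
    Finset.prod_ite_zero, Finset.mem_univ, true_imp_iff, funext_iff, Finset.prod_const_one]

theorem pauliString_mul_self (p : Fin n → Fin 4) :
    (pauliString p * pauliString p : QMatrix n) = 1 := by
  have h : ∀ a, pauliMatrix a * pauliMatrix a = 1 := by
    intro a
    fin_cases a <;> ext i j <;> fin_cases i <;> fin_cases j <;>
      simp [pauliMatrix, Matrix.mul_apply]
  ext x y
  rw [pauliString_mul_apply]
  simp only [h, Matrix.one_apply,
    Finset.prod_ite_zero, Finset.mem_univ, true_imp_iff, funext_iff, Finset.prod_const_one]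

theorem isHermitian_pauliString (p : Fin n → Fin 4) :
    (pauliString p : QMatrix n).IsHermitian := by
  have h : ∀ a i j, star (pauliMatrix a j i) = pauliMatrix a i j := by
    intro a i j
    fin_cases a <;> fin_cases i <;> fin_cases j <;> simp [pauliMatrix]
  ext x y
  simp only [Matrix.conjTranspose_apply, pauliString, Matrix.of_apply, star_prod, h]

/-- Conjugation by a Pauli string multiplies every Pauli string by a sign. -/
theorem pauliString_conj (r p : Fin n → Fin 4) :
    (pauliString r * pauliString p * pauliString r : QMatrix n) =
      (stringSign r p : ℂ) • pauliString p := by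
  rw [pauliString_mul_comm, Matrix.smul_mul, Matrix.mul_assoc, pauliString_mul_self,
    Matrix.mul_one]

/-- Half of all Pauli strings anticommute with a given one other than the identity. -/
theorem sum_stringSign {p : Fin n → Fin 4} (hp : p ≠ 0) : ∑ q, stringSign p q = 0 := by
  have := sum_stringSign_mul_stringSign p 0
  simpa only [stringSign_zero_right, mul_one, if_neg hp, stringSign_comm _ p] using this

/-! ### Clifford unitaries -/

/-- A Hermitian involution that conjugates Pauli strings to Pauli strings, up to powers of `i`, is a
Clifford unitary. -/
theorem exists_clifford_of_conj {V : QMatrix n} (hV : V.IsHermitian) (hVV : V * V = 1)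
    (h : ∀ p : Fin n → Fin 4, ∃ (k : ℕ) (r : Fin n → Fin 4),
      V * pauliString p * V = Complex.I ^ k • pauliString r) :
    ∃ g : cliffordGroup n, ((g : QUnitary n) : QMatrix n) = V := by
  have hU : V ∈ Matrix.unitaryGroup (Qubits n) ℂ := by
    rw [Matrix.mem_unitaryGroup_iff, Matrix.star_eq_conjTranspose, hV.eq, hVV]
  let g : QUnitary n := ⟨V, hU⟩
  have hgg : g * g = 1 := Subtype.ext hVV
  have hinv : g⁻¹ = g := inv_eq_of_mul_eq_one_left hgg
  have hconj : ∀ P ∈ pauliGroup n, g * P * g⁻¹ ∈ pauliGroup n := by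
    rintro P ⟨k, p, hP⟩
    obtain ⟨l, r, hr⟩ := h p
    refine ⟨⟨(k + l) % 4, Nat.mod_lt _ (by norm_num)⟩, r, ?_⟩
    rw [hinv]
    change V * (P : QMatrix n) * V = Complex.I ^ ((k + l) % 4) • pauliString r
    rw [← Complex.I_pow_eq_pow_mod, hP, Matrix.mul_smul, Matrix.smul_mul, hr, smul_smul, pow_add]
  refine ⟨⟨g, fun P => ⟨hconj P, fun hP => ?_⟩⟩, rfl⟩
  have := hconj _ hP
  rw [hinv] at this
  rwa [show g * (g * P * g) * g = g * g * P * (g * g) by group, hgg, one_mul, mul_one] at this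

theorem exists_clifford_pauliString (r : Fin n → Fin 4) :
    ∃ g : cliffordGroup n, ((g : QUnitary n) : QMatrix n) = pauliString r := by
  refine exists_clifford_of_conj (isHermitian_pauliString r) (pauliString_mul_self r) fun p => ?_
  rw [pauliString_conj]
  rcases stringSign_eq_or r p with h | h
  · exact ⟨0, p, by simp [h]⟩
  · exact ⟨2, p, by simp [h]⟩

/-- For anticommuting Pauli strings `P` and `Q`, the Hermitian involution `(P + Q) / √2` is a
Clifford unitary that conjugates `P` to `Q`. -/
theorem exists_clifford_conj {p q : Fin n → Fin 4} (hpq : stringSign p q = -1) :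
    ∃ g : cliffordGroup n, ((g : QUnitary n) : QMatrix n).IsHermitian ∧
      ((g : QUnitary n) : QMatrix n) * pauliString p * ((g : QUnitary n) : QMatrix n) =
        pauliString q := by
  set P : QMatrix n := pauliString p
  set Q : QMatrix n := pauliString q
  have hP : P * P = 1 := pauliString_mul_self p
  have hQ : Q * Q = 1 := pauliString_mul_self q
  have hPQ : P * Q = -(Q * P) := by
    have := pauliString_mul_comm p q
    rwa [hpq, Complex.ofReal_neg, Complex.ofReal_one, neg_one_smul] at this
  let c : ℂ := ((√2)⁻¹ : ℝ)
  have hc : c * c = 2⁻¹ := by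
    rw [← Complex.ofReal_mul, ← mul_inv, Real.mul_self_sqrt (by norm_num)]
    norm_num
  have hconj : ∀ R : QMatrix n,
      (c • (P + Q)) * R * (c • (P + Q)) = (2⁻¹ : ℂ) • ((P + Q) * R * (P + Q)) := by
    intro R
    simp only [Matrix.smul_mul, Matrix.mul_smul, smul_smul, hc]
  have hherm : (c • (P + Q)).IsHermitian := by
    rw [Matrix.IsHermitian, Matrix.conjTranspose_smul, Matrix.conjTranspose_add,
      (isHermitian_pauliString p).eq, (isHermitian_pauliString q).eq]
    simp [c, P, Q]
  have hhalf : ∀ R : QMatrix n, (2⁻¹ : ℂ) • (R + R) = R := by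
    intro R
    rw [← two_smul ℂ R, smul_smul, inv_mul_cancel₀ two_ne_zero, one_smul]
  have hinv : (c • (P + Q)) * (c • (P + Q)) = 1 := by
    have := hconj 1
    rw [Matrix.mul_one, Matrix.mul_one] at this
    rw [this, show (P + Q) * (P + Q) = 1 + 1 by
      simp only [mul_add, add_mul, hP, hQ, hPQ]; abel, hhalf]
  obtain ⟨g, hg⟩ := exists_clifford_of_conj hherm hinv fun r => by
    rw [hconj]
    set R : QMatrix n := pauliString r
    have h₁ : R * P = (stringSign r p : ℂ) • (P * R) := pauliString_mul_comm r p
    have h₂ : R * Q = (stringSign r q : ℂ) • (Q * R) := pauliString_mul_comm r q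
    have hexp : (P + Q) * R * (P + Q) =
        (stringSign r p : ℂ) • (R + Q * P * R) + (stringSign r q : ℂ) • (R - Q * P * R) := by
      -- Moving `R` past `P` and `Q` costs signs, and `(P + Q) P = 1 + Q P`, `(P + Q) Q = 1 - Q P`.
      rw [mul_assoc, mul_add, h₁, h₂, add_mul, mul_add, mul_add]
      simp only [Matrix.mul_smul, ← mul_assoc, hP, hQ, hPQ, one_mul, smul_add, smul_sub, neg_mul,
        smul_neg]
      abel
    obtain ⟨k, s, hs⟩ := exists_pauliString_mul q p
    obtain ⟨l, t, ht⟩ := exists_pauliString_mul s r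
    have hQPR : Q * P * R = Complex.I ^ (k + l) • pauliString t := by
      rw [hs, Matrix.smul_mul, ht, smul_smul, pow_add]
    rw [hexp]
    rcases stringSign_eq_or r p with h | h <;> rcases stringSign_eq_or r q with h' | h' <;>
      simp only [h, h', Complex.ofReal_neg, Complex.ofReal_one, neg_smul, one_smul]
    · exact ⟨0, r, by rw [show R + Q * P * R + (R - Q * P * R) = R + R by abel, hhalf]; simp [R]⟩
    · refine ⟨k + l, t, ?_⟩
      rw [show R + Q * P * R + -(R - Q * P * R) = Q * P * R + Q * P * R by abel, hhalf, hQPR]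
    · refine ⟨2 + (k + l), t, ?_⟩
      rw [show -(R + Q * P * R) + (R - Q * P * R) = -(Q * P * R) + -(Q * P * R) by abel, hhalf,
        hQPR, pow_add _ 2, Complex.I_sq, neg_one_mul, neg_smul]
    · refine ⟨2, r, ?_⟩
      rw [show -(R + Q * P * R) + -(R - Q * P * R) = -R + -R by abel, hhalf]
      simp [R]
  refine ⟨g, hg ▸ hherm, ?_⟩
  rw [hg, hconj, show (P + Q) * P * (P + Q) = Q + Q by
    rw [add_mul, hP, add_mul, mul_add, mul_add, mul_assoc Q P P, hP, mul_assoc Q P Q, hPQ,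
      mul_neg, ← mul_assoc Q Q P, hQ]
    simp only [mul_one, one_mul]
    abel, hhalf]

/-! ### Pauli coefficients -/

/-- The coefficient `tr (A P)` of a Hermitian matrix `A` at the Pauli string `P` with label `p`; the
trace is real, as both matrices are Hermitian. -/
def pauliCoeff (A : QMatrix n) (p : Fin n → Fin 4) : ℝ := (A * pauliString p).trace.re

theorem trace_mul_im_eq_zero {A B : QMatrix n} (hA : A.IsHermitian) (hB : B.IsHermitian) :
    (A * B).trace.im = 0 := by
  rw [← Complex.conj_eq_iff_im, starRingEnd_apply, ← Matrix.trace_conjTranspose,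
    Matrix.conjTranspose_mul, hA.eq, hB.eq, Matrix.trace_mul_comm]

/-- Completeness of the Pauli strings in terms of traces. -/
theorem sum_trace_mul_trace (A B : QMatrix n) :
    ∑ p : Fin n → Fin 4, (A * pauliString p).trace * (B * pauliString p).trace =
      2 ^ n * (A * B).trace := by
  have h : ∀ p : Fin n → Fin 4, (A * pauliString p).trace * (B * pauliString p).trace =
      ∑ x, ∑ y, ∑ z, ∑ w, A x y * B z w *
        ((pauliString p : QMatrix n) y x * (pauliString p : QMatrix n) w z) := by
    intro p
    simp only [Matrix.trace, Matrix.diag, Matrix.mul_apply, Finset.sum_mul_sum]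
    refine Finset.sum_congr rfl fun x _ => ?_
    rw [Finset.sum_comm]
    refine Finset.sum_congr rfl fun y _ => Finset.sum_congr rfl fun z _ =>
      Finset.sum_congr rfl fun w _ => ?_
    ring
  simp only [h]
  rw [Finset.sum_comm]
  simp only [Matrix.trace, Matrix.diag, Matrix.mul_apply, Finset.mul_sum]
  refine Finset.sum_congr rfl fun x _ => ?_
  rw [Finset.sum_comm]
  refine Finset.sum_congr rfl fun y _ => ?_
  rw [Finset.sum_comm, Finset.sum_eq_single y ?_ (by simp)]
  · rw [Finset.sum_comm, Finset.sum_eq_single x ?_ (by simp)]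
    · rw [← Finset.mul_sum, sum_pauliString_mul_pauliString]
      simp [mul_comm]
    · intro w _ hw
      rw [← Finset.mul_sum, sum_pauliString_mul_pauliString, if_neg (by tauto), mul_zero]
  · intro z _ hz
    rw [Finset.sum_comm]
    refine Finset.sum_eq_zero fun w _ => ?_
    rw [← Finset.mul_sum, sum_pauliString_mul_pauliString, if_neg (by tauto), mul_zero]

/-- Parseval's identity for the Pauli strings. Only one factor has to be Hermitian, as only real parts
are compared. -/
theorem sum_pauliCoeff_mul_pauliCoeff {A : QMatrix n} (hA : A.IsHermitian)
    (B : QMatrix n) :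
    ∑ p, pauliCoeff A p * pauliCoeff B p = 2 ^ n * (A * B).trace.re := by
  have h := congrArg Complex.re (sum_trace_mul_trace A B)
  rw [Complex.re_sum, ← Complex.ofReal_ofNat, ← Complex.ofReal_pow, Complex.re_ofReal_mul] at h
  rw [← h]
  refine Finset.sum_congr rfl fun p _ => ?_
  rw [Complex.mul_re, trace_mul_im_eq_zero hA (isHermitian_pauliString p), zero_mul, sub_zero]
  rfl

theorem pauliCoeff_zero (A : QMatrix n) : pauliCoeff A 0 = A.trace.re := by
  rw [pauliCoeff, pauliString_zero, Matrix.mul_one]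

/-! ### Stabilizer states -/

theorem isHermitian_ketBra (ψ : Qubits n → ℂ) : (ketBra ψ).IsHermitian := by
  ext x y
  simp [ketBra, Matrix.vecMulVec_apply, mul_comm]

theorem isHermitian_stab (σ : Stab n) : (σ : QMatrix n).IsHermitian := by
  obtain ⟨_, C, rfl⟩ := σ
  exact isHermitian_ketBra _

theorem star_cliffordKet_dotProduct (C : cliffordGroup n) :
    star (cliffordKet C) ⬝ᵥ cliffordKet C = 1 := by
  have h : ((C : QUnitary n) : QMatrix n)ᴴ * ((C : QUnitary n) : QMatrix n) = 1 :=
    Matrix.mem_unitaryGroup_iff'.1 (C : QUnitary n).2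
  rw [cliffordKet, Matrix.star_mulVec, Matrix.dotProduct_mulVec, Matrix.vecMul_vecMul, h]
  simp

theorem trace_ketBra_mul_ketBra (φ ψ : Qubits n → ℂ) :
    (ketBra φ * ketBra ψ).trace = (star φ ⬝ᵥ ψ) * (star ψ ⬝ᵥ φ) := by
  rw [ketBra, ketBra, Matrix.vecMulVec_mul_vecMulVec, Matrix.trace_vecMulVec,
    dotProduct_smul, smul_eq_mul, dotProduct_comm φ]

theorem trace_ketBra_mul_ketBra_re_nonneg (φ ψ : Qubits n → ℂ) :
    0 ≤ (ketBra φ * ketBra ψ).trace.re := by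
  have h : star ψ ⬝ᵥ φ = star (star φ ⬝ᵥ ψ) := by
    rw [Matrix.star_dotProduct]
  rw [trace_ketBra_mul_ketBra, h, Complex.star_def, Complex.mul_conj, Complex.ofReal_re]
  exact Complex.normSq_nonneg _

theorem trace_stab_mul_stab_re_nonneg (σ ρ : Stab n) :
    0 ≤ ((σ : QMatrix n) * (ρ : QMatrix n)).trace.re := by
  obtain ⟨_, C, rfl⟩ := σ
  obtain ⟨_, C', rfl⟩ := ρ
  exact trace_ketBra_mul_ketBra_re_nonneg _ _

theorem trace_stab_mul_self (σ : Stab n) : ((σ : QMatrix n) * (σ : QMatrix n)).trace = 1 := by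
  obtain ⟨_, C, rfl⟩ := σ
  rw [trace_ketBra_mul_ketBra, star_cliffordKet_dotProduct, mul_one]

theorem trace_stab (σ : Stab n) : (σ : QMatrix n).trace = 1 := by
  obtain ⟨_, C, rfl⟩ := σ
  change (Matrix.vecMulVec (cliffordKet C) (star (cliffordKet C))).trace = 1
  rw [Matrix.trace_vecMulVec, dotProduct_comm, star_cliffordKet_dotProduct]

/-- The Clifford group acts on stabilizer states by conjugation. -/
theorem stabState_mul (g C : cliffordGroup n) :
    (stabState (g * C) : QMatrix n) =
      ((g : QUnitary n) : QMatrix n) * (stabState C : QMatrix n) *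
        ((g : QUnitary n) : QMatrix n)ᴴ := by
  have h : cliffordKet (g * C) = ((g : QUnitary n) : QMatrix n) *ᵥ cliffordKet C := by
    rw [cliffordKet, cliffordKet, Matrix.mulVec_mulVec]
    rfl
  change ketBra (cliffordKet (g * C)) = _ * ketBra (cliffordKet C) * _
  simp only [h, ketBra, Matrix.mul_vecMulVec, Matrix.vecMulVec_mul, Matrix.star_mulVec]

theorem pauliCoeff_stabState_mul {g : cliffordGroup n}
    (hg : ((g : QUnitary n) : QMatrix n).IsHermitian) {p q : Fin n → Fin 4} {s : ℝ}
    (h : ((g : QUnitary n) : QMatrix n) * pauliString p * ((g : QUnitary n) : QMatrix n) =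
      (s : ℂ) • pauliString q) (C : cliffordGroup n) :
    pauliCoeff (stabState (g * C) : QMatrix n) p =
      s * pauliCoeff (stabState C : QMatrix n) q := by
  rw [pauliCoeff, pauliCoeff, stabState_mul, hg.eq, Matrix.mul_assoc, Matrix.mul_assoc,
    Matrix.trace_mul_comm, Matrix.mul_assoc, h, Matrix.mul_smul, Matrix.trace_smul, smul_eq_mul,
    Complex.re_ofReal_mul]

theorem continuous_stabState :
    Continuous fun C : cliffordGroup n => (stabState C : QMatrix n) := by
  have h : Continuous fun C : cliffordGroup n => cliffordKet C := by
    unfold cliffordKet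
    have h₀ : Continuous fun C : cliffordGroup n => ((C : QUnitary n) : QMatrix n) :=
      continuous_subtype_val.comp continuous_subtype_val
    exact h₀.matrix_mulVec continuous_const
  exact h.matrix_vecMulVec h.star

/-! ### Moments of the Pauli coefficients of a random stabilizer state -/

instance instIsMulLeftInvariantClifford (n : ℕ) : (cliffordMeasure n).IsMulLeftInvariant := by
  unfold cliffordMeasure
  infer_instance

theorem integrable_of_continuous {f : cliffordGroup n → ℝ} (hf : Continuous f) :
    Integrable f (cliffordMeasure n) :=
  hf.integrable_of_hasCompactSupport (HasCompactSupport.of_compactSpace f)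

theorem continuous_trace_stabState_mul (B : QMatrix n) :
    Continuous fun C : cliffordGroup n => ((stabState C : QMatrix n) * B).trace.re :=
  Complex.continuous_re.comp (continuous_stabState.matrix_mul continuous_const).matrix_trace

theorem continuous_pauliCoeff_stabState (p : Fin n → Fin 4) :
    Continuous fun C : cliffordGroup n => pauliCoeff (stabState C : QMatrix n) p :=
  continuous_trace_stabState_mul _

/-- Different Pauli coefficients of a random stabilizer state are uncorrelated: conjugation by a
random Pauli string multiplies their product by a sign of mean zero. -/
theorem integral_pauliCoeff_mul_pauliCoeff {p q : Fin n → Fin 4} (hpq : p ≠ q) :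
    ∫ C, pauliCoeff (stabState C : QMatrix n) p * pauliCoeff (stabState C : QMatrix n) q
      ∂(cliffordMeasure n) = 0 := by
  set I := ∫ C, pauliCoeff (stabState C : QMatrix n) p * pauliCoeff (stabState C : QMatrix n) q
      ∂(cliffordMeasure n) with hI
  have h : ∀ r : Fin n → Fin 4, I = stringSign r p * stringSign r q * I := by
    intro r
    obtain ⟨g, hg⟩ := exists_clifford_pauliString r
    have hherm : ((g : QUnitary n) : QMatrix n).IsHermitian := hg ▸ isHermitian_pauliString r
    have hconj : ∀ p, ((g : QUnitary n) : QMatrix n) * pauliString p *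
        ((g : QUnitary n) : QMatrix n) = (stringSign r p : ℂ) • pauliString p :=
      fun p => hg ▸ pauliString_conj r p
    conv_lhs => rw [hI, ← integral_mul_left_eq_self _ g]
    rw [hI, ← integral_const_mul]
    refine integral_congr_ae (.of_forall fun C => ?_)
    simp only [pauliCoeff_stabState_mul hherm (hconj _)]
    ring
  have hsum : ∑ _r : Fin n → Fin 4, I = 0 := by
    rw [Finset.sum_congr rfl fun r _ => h r, ← Finset.sum_mul, sum_stringSign_mul_stringSign,
      if_neg hpq, zero_mul]
  simpa using hsum

theorem integral_pauliCoeff_sq_eq {p q : Fin n → Fin 4} (hpq : stringSign p q = -1) :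
    ∫ C, pauliCoeff (stabState C : QMatrix n) p ^ 2 ∂(cliffordMeasure n) =
      ∫ C, pauliCoeff (stabState C : QMatrix n) q ^ 2 ∂(cliffordMeasure n) := by
  obtain ⟨g, hherm, hconj⟩ := exists_clifford_conj hpq
  rw [← integral_mul_left_eq_self _ g]
  have hconj' : ((g : QUnitary n) : QMatrix n) * pauliString p * ((g : QUnitary n) : QMatrix n) =
      ((1 : ℝ) : ℂ) • pauliString q := by rw [hconj, Complex.ofReal_one, one_smul]
  simp only [pauliCoeff_stabState_mul hherm hconj', one_mul]

/-- The squares of the Pauli coefficients of a state add up to `2 ^ n`, and half of all Pauli strings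
anticommute with a given `P ≠ 1` and so have coefficients of the same second moment as `P`. -/
theorem integral_pauliCoeff_sq_le {p : Fin n → Fin 4} (hp : p ≠ 0) :
    ∫ C, pauliCoeff (stabState C : QMatrix n) p ^ 2 ∂(cliffordMeasure n) ≤ 2 / 2 ^ n := by
  set w : (Fin n → Fin 4) → ℝ := fun p =>
    ∫ C, pauliCoeff (stabState C : QMatrix n) p ^ 2 ∂(cliffordMeasure n) with hw
  change w p ≤ _
  have hw₀ : ∀ q, 0 ≤ w q := fun q => integral_nonneg fun C => sq_nonneg _
  have hsum : ∑ q, w q = 2 ^ n := by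
    have hint : ∀ q ∈ Finset.univ, Integrable (fun C : cliffordGroup n =>
        pauliCoeff (stabState C : QMatrix n) q ^ 2) (cliffordMeasure n) := fun q _ =>
      integrable_of_continuous ((continuous_pauliCoeff_stabState q).pow 2)
    simp only [hw]
    rw [← integral_finsetSum _ hint]
    simp only [sq, sum_pauliCoeff_mul_pauliCoeff (isHermitian_stab _),
      trace_stab_mul_self, Complex.one_re, mul_one, integral_const, probReal_univ, one_smul]
  have hle : ∀ q, (1 - stringSign p q) / 2 * w p ≤ w q := by
    intro q
    rcases stringSign_eq_or p q with h | h
    · rw [h, sub_self, zero_div, zero_mul]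
      exact hw₀ q
    · rw [h, hw]
      simp only
      rw [integral_pauliCoeff_sq_eq h]
      norm_num
  have h : (4 ^ n / 2 : ℝ) * w p ≤ 2 ^ n := by
    have := Finset.sum_le_sum fun q (_ : q ∈ Finset.univ) => hle q
    rw [← Finset.sum_mul, ← Finset.sum_div, Finset.sum_sub_distrib, sum_stringSign hp, hsum] at this
    simpa using this
  rw [show (4 : ℝ) ^ n = 2 ^ n * 2 ^ n by rw [← mul_pow]; norm_num] at h
  have hpos : (0 : ℝ) < 2 ^ n := by positivity
  rw [le_div_iff₀ hpos]
  nlinarith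

/-- The mean of a random stabilizer state is the maximally mixed state, as seen by its overlaps. -/
theorem integral_trace_stabState_mul_stab (σ : Stab n) :
    ∫ C, ((stabState C : QMatrix n) * (σ : QMatrix n)).trace.re ∂(cliffordMeasure n) =
      (2 ^ n)⁻¹ := by
  have hpos : (2 : ℝ) ^ n ≠ 0 := by positivity
  have h₁ : ∀ C : cliffordGroup n, pauliCoeff (stabState C : QMatrix n) 0 = 1 := fun C => by
    rw [pauliCoeff_zero, trace_stab, Complex.one_re]
  refine eq_inv_of_mul_eq_one_right ?_
  rw [← integral_const_mul]
  simp only [← sum_pauliCoeff_mul_pauliCoeff (isHermitian_stab _)]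
  rw [integral_finsetSum _ fun p _ => (integrable_of_continuous
    (continuous_pauliCoeff_stabState p)).mul_const _, Finset.sum_eq_single 0 ?_ (by simp)]
  · simp [h₁, pauliCoeff_zero, trace_stab]
  · intro p _ hp
    have := integral_pauliCoeff_mul_pauliCoeff hp
    simp only [h₁, mul_one] at this
    rw [integral_mul_const, this, zero_mul]

/-! ### Concentration of the expectation of an observable -/

/-- The columns of a matrix of operator norm at most one are vectors of norm at most one. -/
theorem trace_observable_sq_le (O : Observable n) : (O.1 * O.1).trace.re ≤ 2 ^ n := by
  have hcol : ∀ x, ∑ y, ‖O.1 y x‖ ^ 2 ≤ 1 := by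
    intro x
    have h := (Matrix.toEuclideanCLM (𝕜 := ℂ) O.1).le_of_opNorm_le O.2.2
      (EuclideanSpace.single x (1 : ℂ))
    rw [PiLp.norm_single, norm_one, mul_one, EuclideanSpace.norm_eq,
      Real.sqrt_le_one] at h
    simpa [Matrix.toEuclideanCLM_toLp, EuclideanSpace.single] using h
  have htr : (O.1 * O.1).trace.re = ∑ x, ∑ y, ‖O.1 y x‖ ^ 2 := by
    simp only [Matrix.trace, Matrix.diag, Matrix.mul_apply, Complex.re_sum]
    refine Finset.sum_congr rfl fun x _ => Finset.sum_congr rfl fun y _ => ?_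
    rw [← O.2.1.apply x y, Complex.star_def, ← Complex.normSq_eq_conj_mul_self, Complex.ofReal_re,
      Complex.normSq_eq_norm_sq]
  rw [htr]
  refine (Finset.sum_le_sum fun x _ => hcol x).trans ?_
  simp

/-- The variance of `tr(ρ O)` for a random stabilizer state `ρ`, whose mean is `tr(O) / 2 ^ n`. -/
theorem integral_trace_sub_sq_le (O : Observable n) :
    ∫ C, (((stabState C : QMatrix n) * O.1).trace.re - O.1.trace.re / 2 ^ n) ^ 2
      ∂(cliffordMeasure n) ≤ 2 / 2 ^ n := by
  have hpos : (0 : ℝ) < 2 ^ n := by positivity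
  let s : Finset (Fin n → Fin 4) := Finset.univ.erase 0
  have hexp : ∀ C : cliffordGroup n,
      (((stabState C : QMatrix n) * O.1).trace.re - O.1.trace.re / 2 ^ n) ^ 2 =
      ((2 : ℝ) ^ n * 2 ^ n)⁻¹ * ∑ p ∈ s, ∑ q ∈ s, pauliCoeff O.1 p * pauliCoeff O.1 q *
        (pauliCoeff (stabState C : QMatrix n) p * pauliCoeff (stabState C : QMatrix n) q) := by
    intro C
    have h := sum_pauliCoeff_mul_pauliCoeff (isHermitian_stab (stabState C)) O.1
    rw [← Finset.add_sum_erase _ _ (Finset.mem_univ 0), pauliCoeff_zero, pauliCoeff_zero,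
      trace_stab, Complex.one_re, one_mul] at h
    have h' : ((stabState C : QMatrix n) * O.1).trace.re - O.1.trace.re / 2 ^ n =
        (2 ^ n)⁻¹ * ∑ p ∈ s, pauliCoeff (stabState C : QMatrix n) p * pauliCoeff O.1 p := by
      field_simp
      linarith
    rw [h', mul_pow, sq, sq, Finset.sum_mul_sum, mul_inv]
    congr 1
    refine Finset.sum_congr rfl fun p _ => Finset.sum_congr rfl fun q _ => ?_
    ring
  have hint : ∀ p q : Fin n → Fin 4, Integrable (fun C => pauliCoeff O.1 p * pauliCoeff O.1 q *
      (pauliCoeff (stabState C : QMatrix n) p * pauliCoeff (stabState C : QMatrix n) q))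
      (cliffordMeasure n) := fun p q => (integrable_of_continuous
    ((continuous_pauliCoeff_stabState p).mul (continuous_pauliCoeff_stabState q))).const_mul _
  simp only [hexp]
  rw [integral_const_mul, integral_finsetSum _ fun p _ => integrable_finsetSum _ fun q _ => hint p q]
  have hterm : ∀ p ∈ s, ∫ C, ∑ q ∈ s, pauliCoeff O.1 p * pauliCoeff O.1 q *
      (pauliCoeff (stabState C : QMatrix n) p * pauliCoeff (stabState C : QMatrix n) q)
      ∂(cliffordMeasure n) ≤ pauliCoeff O.1 p * pauliCoeff O.1 p * (2 / 2 ^ n) := by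
    intro p hp
    rw [integral_finsetSum _ fun q _ => hint p q, Finset.sum_eq_single p ?_ (fun h => (h hp).elim)]
    · rw [integral_const_mul]
      simp only [← sq]
      exact mul_le_mul_of_nonneg_left (integral_pauliCoeff_sq_le (Finset.ne_of_mem_erase hp))
        (sq_nonneg _)
    · intro q _ hq
      rw [integral_const_mul, integral_pauliCoeff_mul_pauliCoeff hq.symm, mul_zero]
  have hO : ∑ p ∈ s, pauliCoeff O.1 p * pauliCoeff O.1 p ≤ 2 ^ n * 2 ^ n := by
    refine (Finset.sum_le_univ_sum_of_nonneg fun p => mul_self_nonneg _).trans ?_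
    rw [sum_pauliCoeff_mul_pauliCoeff O.2.1]
    exact mul_le_mul_of_nonneg_left (trace_observable_sq_le O) hpos.le
  rw [inv_mul_le_iff₀ (by positivity)]
  refine (Finset.sum_le_sum hterm).trans ?_
  rw [← Finset.sum_mul]
  exact mul_le_mul_of_nonneg_right hO (by positivity)

/-- Chebyshev's inequality for the expectation of an observable in a random stabilizer state. -/
theorem measure_trace_sub_gt_le (O : Observable n) {τ : ℝ} (hτ : 0 < τ) :
    cliffordMeasure n {C | τ < |((stabState C : QMatrix n) * O.1).trace.re -
      O.1.trace.re / 2 ^ n|} ≤ ENNReal.ofReal (2 / (2 ^ n * τ ^ 2)) := by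
  have h := mul_meas_ge_le_integral_of_nonneg (μ := cliffordMeasure n)
    (f := fun C => (((stabState C : QMatrix n) * O.1).trace.re - O.1.trace.re / 2 ^ n) ^ 2)
    (.of_forall fun C => sq_nonneg _) (integrable_of_continuous
      (((continuous_trace_stabState_mul O.1).sub continuous_const).pow 2)) (τ ^ 2)
  rw [← ENNReal.ofReal_toReal (measure_ne_top (cliffordMeasure n) _)]
  refine ENNReal.ofReal_le_ofReal ?_
  rw [← div_div, le_div_iff₀' (by positivity)]
  refine le_trans (mul_le_mul_of_nonneg_left ?_ (sq_nonneg τ))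
    (h.trans (integral_trace_sub_sq_le O))
  refine measureReal_mono fun C hC => ?_
  rw [Set.mem_ofPred_eq, ← sq_abs (_ - _)]
  exact pow_le_pow_left₀ hτ.le (le_of_lt hC) 2

/-! ### Query algorithms with changed answers -/

section QueryAlgorithm

variable {X T M : Type*} [MeasurableSpace X] [MeasurableSpace T] [MeasurableSpace M]
  (A : QueryAlgorithm X T M)

theorem QueryAlgorithm.measurable_step {v : X → ℝ} (hv : Measurable v) :
    Measurable fun m => A.update (m, v (A.query m)) :=
  A.update.measurable.comp (measurable_id.prodMk (hv.comp A.measurable_query))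

theorem QueryAlgorithm.isProbabilityMeasure_memoryLaw {v : X → ℝ} (hv : Measurable v) (q : ℕ) :
    IsProbabilityMeasure (A.memoryLaw v q) := by
  have := A.isMarkovKernel_update
  induction q with
  | zero => exact A.isProbabilityMeasure_init
  | succ q ih =>
    exact isProbabilityMeasure_bind (A.measurable_step hv).aemeasurable
      (.of_forall fun m => inferInstance)

/-- The hybrid argument: changing the answers from `v` to `w` changes the expectation of a
`[0, 1]`-valued function of the memory by at most the expected number of queries whose answers
change. -/
theorem QueryAlgorithm.lintegral_memoryLaw_le {v w : X → ℝ} (hv : Measurable v)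
    (hw : Measurable w) (q : ℕ) {f : M → ℝ≥0∞} (hf : Measurable f) (hf₁ : ∀ m, f m ≤ 1) :
    ∫⁻ m, f m ∂(A.memoryLaw v q) ≤ ∫⁻ m, f m ∂(A.memoryLaw w q) +
      ∑ i ∈ Finset.range q, A.memoryLaw w i {m | v (A.query m) ≠ w (A.query m)} := by
  have := A.isMarkovKernel_update
  induction q generalizing f with
  | zero => simp [QueryAlgorithm.memoryLaw]
  | succ q ih =>
    have hD : MeasurableSet {m | v (A.query m) ≠ w (A.query m)} :=
      (measurableSet_eq_fun (hv.comp A.measurable_query) (hw.comp A.measurable_query)).compl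
    have hstep : ∀ {u : X → ℝ}, Measurable u →
        Measurable fun m => ∫⁻ m', f m' ∂(A.update (m, u (A.query m))) := fun hu =>
      (Measure.measurable_lintegral hf).comp (A.measurable_step hu)
    have hone : ∀ x, ∫⁻ m', f m' ∂(A.update x) ≤ 1 := fun x =>
      (lintegral_mono hf₁).trans (by simp)
    rw [QueryAlgorithm.memoryLaw, QueryAlgorithm.memoryLaw,
      Measure.lintegral_bind (A.measurable_step hv).aemeasurable hf.aemeasurable,
      Measure.lintegral_bind (A.measurable_step hw).aemeasurable hf.aemeasurable,
      Finset.sum_range_succ, ← add_assoc, add_right_comm]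
    refine (ih (hstep hv) fun m => hone _).trans (add_le_add_left ?_ _)
    rw [← lintegral_indicator_one hD, ← lintegral_add_left (hstep hw)]
    refine lintegral_mono fun m => ?_
    by_cases hm : v (A.query m) = w (A.query m)
    · simp only [hm]
      exact le_self_add
    · refine (hone _).trans ?_
      rw [Set.indicator_of_mem (show m ∈ {m | v (A.query m) ≠ w (A.query m)} from hm)]
      exact le_add_self

theorem QueryAlgorithm.outputProb_le {v w : X → ℝ} (hv : Measurable v) (hw : Measurable w) (q : ℕ)
    {S : Set T} (hS : MeasurableSet S) :
    A.outputProb v q S ≤ A.outputProb w q S +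
      ∑ i ∈ Finset.range q, A.memoryLaw w i {m | v (A.query m) ≠ w (A.query m)} := by
  have hS' : MeasurableSet (A.output ⁻¹' S) := A.measurable_output hS
  have h := A.lintegral_memoryLaw_le hv hw q (f := (A.output ⁻¹' S).indicator 1)
    (measurable_one.indicator hS') fun m => Set.indicator_le_self' (by simp) m
  rwa [lintegral_indicator_one hS', lintegral_indicator_one hS'] at h

end QueryAlgorithm

/-! ### Uninformative oracles -/

instance instBorelSpaceObservable (n : ℕ) : BorelSpace (Observable n) := ⟨rfl⟩

theorem continuous_observable_val : Continuous fun O : Observable n => (O.1 : QMatrix n) :=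
  continuous_subtype_val

/-- The answer `tr(O) / 2 ^ n`, the expectation of `O` in the maximally mixed state. -/
noncomputable def mixedAnswer (O : Observable n) : ℝ := O.1.trace.re / 2 ^ n

open Classical in
/-- The answers to queries about `σ` that give nothing away whenever this is allowed: `mixedAnswer O`
if it lies within `τ` of `tr(σ O)`, and the exact value `tr(σ O)` otherwise. -/
noncomputable def uninformativeAnswer (τ : ℝ) (σ : QMatrix n) (O : Observable n) : ℝ :=
  if |(σ * O.1).trace.re - mixedAnswer O| ≤ τ then mixedAnswer O else (σ * O.1).trace.re

theorem measurable_mixedAnswer : Measurable (mixedAnswer : Observable n → ℝ) :=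
  ((Complex.continuous_re.comp continuous_observable_val.matrix_trace).div_const _).measurable

theorem isQStat_uninformativeAnswer {τ : ℝ} (hτ : 0 ≤ τ) (σ : QMatrix n) :
    IsQStat τ σ (uninformativeAnswer τ σ) := by
  have hσ : Measurable fun O : Observable n => (σ * O.1).trace.re :=
    (Complex.continuous_re.comp
      (continuous_const.matrix_mul continuous_observable_val).matrix_trace).measurable
  refine ⟨Measurable.ite (measurableSet_le ?_ measurable_const) measurable_mixedAnswer hσ,
    fun O => ?_⟩
  · exact (hσ.sub measurable_mixedAnswer).abs
  · unfold uninformativeAnswer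
    split_ifs with h
    · rwa [abs_sub_comm]
    · simpa using hτ

theorem lt_of_uninformativeAnswer_ne {τ : ℝ} {σ : QMatrix n} {O : Observable n}
    (h : uninformativeAnswer τ σ O ≠ mixedAnswer O) :
    τ < |(σ * O.1).trace.re - mixedAnswer O| := by
  by_contra! hle
  exact h (if_pos hle)

/-- The trace of a product is jointly measurable, entry by entry; joint measurability would not
follow from joint continuity, as the product `σ`-algebra may be smaller than the Borel one. -/
theorem measurable_trace_mul_re {Y : Type*} [MeasurableSpace Y] {F G : Y → QMatrix n}
    (hF : ∀ x y, Measurable fun a => F a x y) (hG : ∀ x y, Measurable fun a => G a x y) :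
    Measurable fun a => (F a * G a).trace.re := by
  simp only [Matrix.trace, Matrix.diag, Matrix.mul_apply]
  exact Complex.measurable_re.comp (Finset.measurable_sum _ fun x _ =>
    Finset.measurable_sum _ fun y _ => (hF x y).mul (hG y x))

theorem measurable_stabState_apply (x y : Qubits n) :
    Measurable fun C : cliffordGroup n => (stabState C : QMatrix n) x y :=
  (continuous_stabState.matrix_elem x y).measurable

theorem measurable_observable_apply (x y : Qubits n) :
    Measurable fun O : Observable n => O.1 x y :=
  (continuous_observable_val.matrix_elem x y).measurable

/-- A random stabilizer state is guessed correctly with probability at most `2 ^ (-n)`: the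
probability of `ρ = σ` is bounded by the expectation of the overlap `tr(ρ σ)`. -/
theorem lintegral_measure_singleton_stabState_le (ν : Measure (Stab n)) [IsProbabilityMeasure ν] :
    ∫⁻ C, ν {stabState C} ∂(cliffordMeasure n) ≤ ENNReal.ofReal (2 ^ n)⁻¹ := by
  let f : cliffordGroup n → Stab n → ℝ≥0∞ := fun C σ =>
    ENNReal.ofReal ((stabState C : QMatrix n) * (σ : QMatrix n)).trace.re
  have hf : Measurable (Function.uncurry f) := ENNReal.measurable_ofReal.comp
    (measurable_trace_mul_re (fun x y => (measurable_stabState_apply x y).comp measurable_fst)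
      (fun x y => (measurable_from_top (f := fun σ : Stab n => (σ : QMatrix n) x y)).comp
        measurable_snd))
  have hle : ∀ C, ν {stabState C} ≤ ∫⁻ σ, f C σ ∂ν := by
    intro C
    rw [← lintegral_indicator_one (MeasurableSpace.measurableSet_top)]
    refine lintegral_mono fun σ => Set.indicator_le ?_ σ
    rintro _ rfl
    simp [f, trace_stab_mul_self]
  refine (lintegral_mono hle).trans ?_
  rw [lintegral_lintegral_swap hf.aemeasurable]
  have hint : ∀ σ, ∫⁻ C, f C σ ∂(cliffordMeasure n) = ENNReal.ofReal (2 ^ n)⁻¹ := by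
    intro σ
    rw [← integral_trace_stabState_mul_stab σ, ofReal_integral_eq_lintegral_ofReal
      (integrable_of_continuous (continuous_trace_stabState_mul _))
      (.of_forall fun C => trace_stab_mul_stab_re_nonneg _ σ)]
  simp [hint]

/-- Whatever the law of a query, few stabilizer states are distinguished from the maximally mixed
state by it. -/
theorem lintegral_measure_distinguished_le {M : Type*} [MeasurableSpace M] (ν : Measure M)
    [IsProbabilityMeasure ν] {O : M → Observable n} (hO : Measurable O) {τ : ℝ} (hτ : 0 < τ) :
    Measurable (fun C : cliffordGroup n =>
      ν {m | τ < |((stabState C : QMatrix n) * (O m).1).trace.re - mixedAnswer (O m)|}) ∧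
    ∫⁻ C, ν {m | τ < |((stabState C : QMatrix n) * (O m).1).trace.re - mixedAnswer (O m)|}
      ∂(cliffordMeasure n) ≤ ENNReal.ofReal (2 / (2 ^ n * τ ^ 2)) := by
  let S : Set (cliffordGroup n × M) :=
    {a | τ < |((stabState a.1 : QMatrix n) * (O a.2).1).trace.re - mixedAnswer (O a.2)|}
  have hS : MeasurableSet S := by
    refine measurableSet_lt measurable_const (Measurable.abs (Measurable.sub ?_ ?_))
    · exact measurable_trace_mul_re
        (fun x y => (measurable_stabState_apply x y).comp measurable_fst)
        (fun x y => (measurable_observable_apply x y).comp (hO.comp measurable_snd))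
    · exact measurable_mixedAnswer.comp (hO.comp measurable_snd)
  refine ⟨measurable_measure_prodMk_left hS, ?_⟩
  calc _ = ((cliffordMeasure n).prod ν) S := (Measure.prod_apply hS).symm
    _ = ∫⁻ m, cliffordMeasure n ((fun C => (C, m)) ⁻¹' S) ∂ν := Measure.prod_apply_symm hS
    _ ≤ ∫⁻ _, ENNReal.ofReal (2 / (2 ^ n * τ ^ 2)) ∂ν :=
      lintegral_mono fun m => measure_trace_sub_gt_le (O m) hτ
    _ = _ := by simp

theorem mainTheorem6 (n q : ℕ) (τ β : ℝ) (hτ₀ : 0 < τ) (hτ₁ : τ ≤ 1) (hβ₀ : 0 < β) (hβ₁ : β ≤ 1)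
    {M : Type*} [MeasurableSpace M] (A : QueryAlgorithm (Observable n) (Stab n) M)
    (hA : LearnsStab A q τ β) :
    (q : ℝ) + 1 ≥ β * τ ^ 2 * (2 : ℝ) ^ ((n : ℤ) - 2) := by
  have hpos : (0 : ℝ) < 2 ^ n := by positivity
  set ε : ℝ := 2 / (2 ^ n * τ ^ 2) with hε
  have hε₀ : 0 ≤ ε := by positivity
  set law : ℕ → Measure M := A.memoryLaw mixedAnswer with hlaw
  have hprob : ∀ i, IsProbabilityMeasure (law i) := fun i =>
    A.isProbabilityMeasure_memoryLaw measurable_mixedAnswer i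
  have := Measure.isProbabilityMeasure_map (μ := law q) A.measurable_output.aemeasurable
  let D : cliffordGroup n → Set M := fun C =>
    {m | τ < |((stabState C : QMatrix n) * (A.query m).1).trace.re - mixedAnswer (A.query m)|}
  have hD : ∀ i, Measurable (fun C => law i (D C)) ∧
      ∫⁻ C, law i (D C) ∂(cliffordMeasure n) ≤ ENNReal.ofReal ε := fun i =>
    lintegral_measure_distinguished_le (law i) A.measurable_query hτ₀
  -- The left side need not be shown measurable in `C`: only this bound is split and integrated.
  have hpoint : ∀ C : cliffordGroup n,
      A.outputProb (uninformativeAnswer τ (stabState C : QMatrix n)) q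
        (stabLearning n (stabState C)) ≤
      (law q).map A.output {stabState C} + ∑ i ∈ Finset.range q, law i (D C) := by
    intro C
    refine (A.outputProb_le (isQStat_uninformativeAnswer hτ₀.le _).1 measurable_mixedAnswer q
      (S := stabLearning n (stabState C)) MeasurableSpace.measurableSet_top).trans ?_
    refine add_le_add ?_ (Finset.sum_le_sum fun i _ => measure_mono fun m hm =>
      lt_of_uninformativeAnswer_ne hm)
    rw [Measure.map_apply A.measurable_output MeasurableSpace.measurableSet_top]
    exact le_rfl
  have hmain : ENNReal.ofReal β ≤ ENNReal.ofReal ((2 ^ n)⁻¹ + q * ε) := by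
    refine (hA (fun σ => uninformativeAnswer τ σ) fun σ =>
      isQStat_uninformativeAnswer hτ₀.le _).trans ?_
    refine (lintegral_mono hpoint).trans ?_
    rw [lintegral_add_right _ (Finset.measurable_sum _ fun i _ => (hD i).1),
      lintegral_finsetSum _ fun i _ => (hD i).1,
      ENNReal.ofReal_add (by positivity) (by positivity)]
    refine add_le_add (lintegral_measure_singleton_stabState_le _) ?_
    refine (Finset.sum_le_sum fun i _ => (hD i).2).trans ?_
    rw [Finset.sum_const, Finset.card_range, nsmul_eq_mul, ENNReal.ofReal_mul (by positivity),
      ENNReal.ofReal_natCast]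
  rw [ENNReal.ofReal_le_ofReal_iff (by positivity)] at hmain
  have hτ₂ : τ ^ 2 ≤ 1 := pow_le_one₀ hτ₀.le hτ₁
  have hβ : β * τ ^ 2 * 2 ^ n ≤ τ ^ 2 + 2 * q := by
    calc β * τ ^ 2 * 2 ^ n ≤ ((2 ^ n)⁻¹ + q * ε) * τ ^ 2 * 2 ^ n := by gcongr
      _ = τ ^ 2 + 2 * q := by rw [hε]; field_simp
  have h4 : (2 : ℝ) ^ ((n : ℤ) - 2) = 2 ^ n / 4 := by
    rw [zpow_sub₀ two_ne_zero, zpow_natCast]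
    norm_num
  have hq : (0 : ℝ) ≤ q := q.cast_nonneg
  rw [h4]
  linarith
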